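/- Let $\hat{\mathbb C}=\mathbb C\cup\{\infty\}$ be the Riemann sphere and let $G=\{(z,w)\in\hat{\mathbb C}\times\hat{\mathbb C} : z\neq w\}$, an open subset of $\hat{\mathbb C}\times\hat{\mathbb C}$ and hence a two-dimensional complex manifold. A Fuchsian group is a discrete subgroup $\Gamma$ of $\mathrm{PSL}(2,\mathbb R)$, regarded as a group of Möbius transformations of $\hat{\mathbb C}$ preserving the upper half-plane $\mathbb H$. Its limit set $\Lambda(\Gamma)\subseteq\hat{\mathbb C}$ is the set of all accumulation points of $\Gamma$-orbits of points $z\in\mathbb H$; $\Gamma$ is called elementary if $\Lambda(\Gamma)$ consists of zero, one or two elements, and non-elementary otherwise. Theorem. Let $\Gamma$ be a non-elementary Fuchsian group (not necessarily acting freely on $\mathbb H$). If $F:G\to\mathbb C$ is holomorphic and $F(\gamma z,\gamma w)=F(z,w)$ for all $\gamma\in\Gamma$ and all $(z,w)\in G$, then $F$ is constant. -/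

import Mathlib

open Filter Topology Set
open scoped Manifold ContDiff MatrixGroups

noncomputable section

/-! ### The Riemann sphere as a complex manifold -/

/-- The Riemann sphere `ℂ ∪ {∞}`, with its topology of one-point compactification. -/
abbrev Sphere : Type := OnePoint ℂ

namespace Sphere

/-- The inversion `z ↦ 1 / z` of the Riemann sphere, with `0 ↦ ∞` and `∞ ↦ 0`. -/
def inversion : Sphere → Sphere
  | none => ((0 : ℂ) : Sphere)
  | some z => if z = 0 then OnePoint.infty else ((z⁻¹ : ℂ) : Sphere)

theorem inversion_infty : inversion OnePoint.infty = ((0 : ℂ) : Sphere) := rfl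

theorem inversion_coe (z : ℂ) :
    inversion (z : Sphere) = if z = 0 then OnePoint.infty else ((z⁻¹ : ℂ) : Sphere) := rfl

theorem inversion_coe_of_ne {z : ℂ} (hz : z ≠ 0) :
    inversion (z : Sphere) = ((z⁻¹ : ℂ) : Sphere) := by
  rw [inversion_coe, if_neg hz]

theorem inversion_zero : inversion ((0 : ℂ) : Sphere) = OnePoint.infty := by
  rw [inversion_coe, if_pos rfl]

theorem inversion_involutive : Function.Involutive inversion := by
  intro p
  induction p using OnePoint.rec with
  | infty => rw [inversion_infty, inversion_zero]
  | coe z =>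
    by_cases hz : z = 0
    · rw [hz, inversion_zero, inversion_infty]
    · rw [inversion_coe_of_ne hz, inversion_coe_of_ne (inv_ne_zero hz), inv_inv]

theorem continuous_inversion : Continuous inversion := by
  rw [continuous_iff_continuousAt]
  intro p
  induction p using OnePoint.rec with
  | infty =>
    rw [OnePoint.continuousAt_infty', inversion_infty, coclosedCompact_eq_cocompact,
      ← Metric.cobounded_eq_cocompact]
    refine ((OnePoint.continuous_coe.tendsto (0 : ℂ)).comp
      (tendsto_inv₀_cobounded (α := ℂ))).congr' ?_
    have h : ∀ᶠ z : ℂ in Bornology.cobounded ℂ, z ≠ 0 := by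
      rw [Metric.cobounded_eq_cocompact]
      exact (isCompact_singleton (x := (0 : ℂ))).compl_mem_cocompact
    filter_upwards [h] with z hz
    exact (inversion_coe_of_ne hz).symm
  | coe z =>
    rw [OnePoint.continuousAt_coe]
    by_cases hz : z = 0
    · subst hz
      rw [continuousAt_iff_punctured_nhds]
      have h1 : Tendsto (fun z : ℂ => ((z⁻¹ : ℂ) : Sphere)) (𝓝[≠] 0) (𝓝 OnePoint.infty) := by
        refine (OnePoint.tendsto_coe_infty (X := ℂ)).comp ?_
        rw [coclosedCompact_eq_cocompact, ← Metric.cobounded_eq_cocompact]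
        exact tendsto_inv₀_nhdsNE_zero
      simp only [Function.comp_apply, inversion_zero]
      refine h1.congr' ?_
      filter_upwards [self_mem_nhdsWithin] with z hz
      exact (inversion_coe_of_ne hz).symm
    · have h1 : ContinuousAt (fun z : ℂ => ((z⁻¹ : ℂ) : Sphere)) z :=
        OnePoint.continuous_coe.continuousAt.comp (continuousAt_inv₀ hz)
      refine h1.congr ?_
      filter_upwards [isOpen_ne.mem_nhds hz] with w hw
      exact (inversion_coe_of_ne hw).symm

/-- The inversion as a homeomorphism. -/
def inversionHomeomorph : Sphere ≃ₜ Sphere where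
  toEquiv := inversion_involutive.toPerm
  continuous_toFun := continuous_inversion
  continuous_invFun := continuous_inversion

/-- The chart `z ↦ z` on the complement of `∞`. -/
def chartZero : OpenPartialHomeomorph Sphere ℂ :=
  (OnePoint.isOpenEmbedding_coe (X := ℂ)).toOpenPartialHomeomorph.symm

/-- The chart `z ↦ 1 / z` (with `∞ ↦ 0`) on the complement of `0`. -/
def chartInfty : OpenPartialHomeomorph Sphere ℂ :=
  inversionHomeomorph.toOpenPartialHomeomorph.trans chartZero

theorem chartZero_source : chartZero.source = {OnePoint.infty}ᶜ := by
  simp [chartZero, OnePoint.compl_infty]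

theorem chartZero_coe (z : ℂ) : chartZero (z : Sphere) = z :=
  (OnePoint.isOpenEmbedding_coe (X := ℂ)).toOpenPartialHomeomorph.left_inv (mem_univ z)

theorem chartZero_symm_apply (z : ℂ) : chartZero.symm z = (z : Sphere) := rfl

theorem chartInfty_apply (p : Sphere) : chartInfty p = chartZero (inversion p) := rfl

theorem chartInfty_symm_apply (z : ℂ) : chartInfty.symm z = inversion (z : Sphere) := rfl

theorem chartInfty_source : chartInfty.source = {((0 : ℂ) : Sphere)}ᶜ := by
  ext p
  have h : p ∈ chartInfty.source ↔ inversion p ∈ chartZero.source := by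
    simp [chartInfty, inversionHomeomorph, Function.Involutive.toPerm]
  rw [h, chartZero_source, mem_compl_singleton_iff, mem_compl_singleton_iff, not_iff_not,
    ← inversion_zero]
  exact inversion_involutive.injective.eq_iff

/-- The Riemann sphere is a one-dimensional complex manifold with the two charts `z` and `1 / z`. -/
instance instChartedSpace : ChartedSpace ℂ Sphere where
  atlas := {chartZero, chartInfty}
  chartAt p := by
    classical
    exact if p = OnePoint.infty then chartInfty else chartZero
  mem_chart_source p := by
    by_cases hp : p = OnePoint.infty
    · simp [hp, chartInfty_source]
    · simp [hp, chartZero_source]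
  chart_mem_atlas p := by
    by_cases hp : p = OnePoint.infty <;> simp [hp]

/-- The transition maps are holomorphic. -/
instance instIsManifold : IsManifold 𝓘(ℂ) ω Sphere := by
  have hinv : ContDiffOn ℂ ω (fun z : ℂ => z⁻¹) {z | z ≠ 0} :=
    fun z hz => (contDiffAt_inv ℂ hz).contDiffWithinAt
  refine isManifold_of_contDiffOn 𝓘(ℂ) ω Sphere ?_
  rintro e e' (rfl | rfl) (rfl | rfl)
  · refine contDiffOn_id.congr ?_
    intro z _
    simp [chartZero_symm_apply, chartZero_coe]
  · refine (hinv.congr ?_).mono (t := _) ?_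
    · intro z hz
      simp only [Function.comp_apply, modelWithCornersSelf_coe, modelWithCornersSelf_coe_symm, id,
        OpenPartialHomeomorph.coe_trans, chartZero_symm_apply, chartInfty_apply]
      rw [inversion_coe_of_ne hz, chartZero_coe]
    · rintro z ⟨hz, -⟩
      have h2 : (z : Sphere) ∈ chartInfty.source := hz.2
      rw [chartInfty_source] at h2
      intro h0
      exact h2 (by rw [h0]; rfl)
  · refine (hinv.congr ?_).mono (t := _) ?_
    · intro z hz
      simp only [Function.comp_apply, modelWithCornersSelf_coe, modelWithCornersSelf_coe_symm, id,
        OpenPartialHomeomorph.coe_trans, chartInfty_symm_apply]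
      rw [inversion_coe_of_ne hz, chartZero_coe]
    · rintro z ⟨hz, -⟩
      have h2 : inversion (z : Sphere) ∈ chartZero.source := hz.2
      rw [chartZero_source] at h2
      intro h0
      exact h2 (by rw [h0, inversion_zero]; rfl)
  · refine contDiffOn_id.congr ?_
    intro z _
    simp [chartInfty_symm_apply, chartInfty_apply, inversion_involutive _, chartZero_coe]

end Sphere

/-! ### Möbius transformations preserving the upper half-plane -/

namespace MobiusR

/-- `SL(2, ℝ)` acting on the Riemann sphere by Möbius transformations. -/
def slToPerm : SL(2, ℝ) →* Equiv.Perm Sphere :=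
  (MulAction.toPermHom (GL (Fin 2) ℂ) Sphere).comp (Matrix.SpecialLinearGroup.mapGL ℂ)

theorem slToPerm_infty (g : SL(2, ℝ)) :
    slToPerm g OnePoint.infty =
      if (g 1 0 : ℂ) = 0 then OnePoint.infty else (((g 0 0 : ℂ) / (g 1 0 : ℂ) : ℂ) : Sphere) := by
  simp [slToPerm, OnePoint.smul_infty_eq_ite]

theorem slToPerm_coe (g : SL(2, ℝ)) (z : ℂ) :
    slToPerm g (z : Sphere) =
      if (g 1 0 : ℂ) * z + (g 1 1 : ℂ) = 0 then OnePoint.infty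
      else ((((g 0 0 : ℂ) * z + (g 0 1 : ℂ)) / ((g 1 0 : ℂ) * z + (g 1 1 : ℂ)) : ℂ) : Sphere) := by
  simp [slToPerm, OnePoint.smul_some_eq_ite]

theorem slToPerm_of_mem_center {g : SL(2, ℝ)} (hg : g ∈ Subgroup.center SL(2, ℝ)) :
    slToPerm g = 1 := by
  obtain ⟨r, hr, h⟩ := Matrix.SpecialLinearGroup.mem_center_iff.1 hg
  have hr0 : (r : ℂ) ≠ 0 := by
    intro h0
    have : r = 0 := by exact_mod_cast h0
    simp [this] at hr
  have h00 : g 0 0 = r := by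
    have := congrFun (congrFun h 0) 0
    simpa using this.symm
  have h01 : g 0 1 = 0 := by
    have := congrFun (congrFun h 0) 1
    simpa using this.symm
  have h10 : g 1 0 = 0 := by
    have := congrFun (congrFun h 1) 0
    simpa using this.symm
  have h11 : g 1 1 = r := by
    have := congrFun (congrFun h 1) 1
    simpa using this.symm
  ext1 p
  induction p using OnePoint.rec with
  | infty => rw [slToPerm_infty, h10]; simp
  | coe z => rw [slToPerm_coe, h00, h01, h10, h11]; simp [hr0]

/-- `PSL(2, ℝ)`, the group of conformal automorphisms of the upper half-plane, acting on the
Riemann sphere by Möbius transformations. -/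
def toPerm : PSL(2, ℝ) →* Equiv.Perm Sphere :=
  QuotientGroup.lift _ slToPerm fun _ hg => slToPerm_of_mem_center hg

instance instMulActionSphere : MulAction PSL(2, ℝ) Sphere := MulAction.compHom Sphere toPerm

theorem mk_smul_infty (g : SL(2, ℝ)) :
    (g : PSL(2, ℝ)) • (OnePoint.infty : Sphere) =
      if (g 1 0 : ℂ) = 0 then OnePoint.infty else (((g 0 0 : ℂ) / (g 1 0 : ℂ) : ℂ) : Sphere) :=
  slToPerm_infty g

theorem mk_smul_coe (g : SL(2, ℝ)) (z : ℂ) :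
    (g : PSL(2, ℝ)) • (z : Sphere) =
      if (g 1 0 : ℂ) * z + (g 1 1 : ℂ) = 0 then OnePoint.infty
      else ((((g 0 0 : ℂ) * z + (g 0 1 : ℂ)) / ((g 1 0 : ℂ) * z + (g 1 1 : ℂ)) : ℂ) : Sphere) :=
  slToPerm_coe g z

end MobiusR

/-! ### Fuchsian groups -/

/-- A Fuchsian group: a discrete group of Möbius transformations of the upper half-plane, that is,
a subgroup of `PSL(2, ℝ)` whose subspace topology is discrete. -/
def IsFuchsian (Γ : Subgroup PSL(2, ℝ)) : Prop := DiscreteTopology Γ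

/-- The limit set: all accumulation points in the Riemann sphere of the `Γ`-orbits of points of
the upper half-plane. -/
def limitSet (Γ : Subgroup PSL(2, ℝ)) : Set Sphere :=
  {x | ∃ z : ℂ, 0 < z.im ∧ AccPt x (𝓟 {p : Sphere | ∃ γ ∈ Γ, p = γ • (z : Sphere)})}

/-- `Γ` is elementary if its limit set has zero, one or two elements. -/
def IsElementary (Γ : Subgroup PSL(2, ℝ)) : Prop := (limitSet Γ).encard ≤ 2

/-! ### The second configuration space of the Riemann sphere -/

/-- `G`: the open subset of pairs of distinct points in the product of two Riemann spheres. As an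
open subset of a product of complex manifolds it is a two-dimensional complex manifold. -/
def confTwo : TopologicalSpace.Opens (Sphere × Sphere) where
  carrier := {p | p.1 ≠ p.2}
  is_open' := isOpen_ne_fun continuous_fst continuous_snd

/-- The diagonal action `(z, w) ↦ (γ z, γ w)` on the configuration space. -/
instance confTwo.instMulAction : MulAction PSL(2, ℝ) confTwo where
  smul γ p := ⟨(γ • p.1.1, γ • p.1.2), fun h => p.2 (smul_left_cancel γ h)⟩
  one_smul p := Subtype.ext (Prod.ext (one_smul _ p.1.1) (one_smul _ p.1.2))
  mul_smul a b p := Subtype.ext (Prod.ext (mul_smul a b p.1.1) (mul_smul a b p.1.2))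

/-- Holomorphic functions on the configuration space. -/
def HolomorphicOnConfTwo (F : confTwo → ℂ) : Prop :=
  MDifferentiable (𝓘(ℂ).prod 𝓘(ℂ)) 𝓘(ℂ) F

end

/-! The proof rests on the convergence property (`exists_ultrafilter_of_mem_limitSet`): for a limit
point `x` there are a point `y` and elements `g` of `Γ` with `g → x` pointwise off `y` and `g⁻¹ → y`
pointwise off `x`. It comes from scaling the matrices to norm one: discreteness makes their norms
blow up, so a limit matrix is singular, with image `x` and kernel `y`.

Passing to the limit in `F(g z, v) = F(z, g⁻¹ v)` gives `F(x, v) = F(z, y)` for all `v ≠ x` and `z ≠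
y`, so `F(x, ·)` is constant; likewise `F(·, x)`. Three limit points suffice to link these
constants, so `F(x, ·) = c` with the same `c` for every limit point `x`. By invariance the same
holds at translates of limit points, and these accumulate at a finite limit point. The identity
theorem in the first variable, with the second fixed, gives `F = c` on a dense set, and continuity
finishes. -/

noncomputable section

/-! ### Homogeneous coordinates on the Riemann sphere -/

namespace Sphere

open Classical in
/-- The point of the Riemann sphere with homogeneous coordinates `(u, v)`. -/
def ofHom (q : ℂ × ℂ) : Sphere :=
  if q.2 = 0 then OnePoint.infty else ((q.1 / q.2 : ℂ) : Sphere)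

theorem ofHom_of_ne {q : ℂ × ℂ} (h : q.2 ≠ 0) : ofHom q = ((q.1 / q.2 : ℂ) : Sphere) := if_neg h

theorem ofHom_of_eq {q : ℂ × ℂ} (h : q.2 = 0) : ofHom q = OnePoint.infty := if_pos h

theorem ofHom_coe_one (z : ℂ) : ofHom (z, 1) = (z : Sphere) := by
  rw [ofHom_of_ne one_ne_zero, div_one]

theorem exists_ofHom (p : Sphere) : ∃ q : ℂ × ℂ, q ≠ 0 ∧ ofHom q = p := by
  induction p using OnePoint.rec with
  | infty => exact ⟨(1, 0), by simp, ofHom_of_eq rfl⟩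
  | coe z => exact ⟨(z, 1), by simp, ofHom_coe_one z⟩

theorem ofHom_eq_of_cross {p q : ℂ × ℂ} (hp : p ≠ 0) (hq : q ≠ 0) (h : p.1 * q.2 = q.1 * p.2) :
    ofHom p = ofHom q := by
  obtain ⟨a, b⟩ := p
  obtain ⟨c, d⟩ := q
  simp only [ne_eq, Prod.mk_eq_zero, not_and] at hp hq h
  by_cases hb : b = 0
  · have hd : d = 0 := by
      subst hb
      rw [mul_zero, mul_eq_zero] at h
      exact h.resolve_left fun ha => hp ha rfl
    rw [ofHom_of_eq (by exact hb), ofHom_of_eq (by exact hd)]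
  · have hd : d ≠ 0 := by
      intro hd
      subst hd
      rw [mul_zero, eq_comm, mul_eq_zero] at h
      exact hq (h.resolve_right hb) rfl
    rw [ofHom_of_ne (by exact hb), ofHom_of_ne (by exact hd), (div_eq_div_iff hb hd).2 h]

theorem ofHom_smul {t : ℂ} (ht : t ≠ 0) (q : ℂ × ℂ) : ofHom (t • q) = ofHom q := by
  by_cases h : q = 0
  · simp [h]
  · refine ofHom_eq_of_cross (smul_ne_zero ht h) h ?_
    simp only [Prod.smul_fst, Prod.smul_snd, smul_eq_mul]
    ring

theorem ofHom_eq_inversion {q : ℂ × ℂ} (hq : q ≠ 0) : ofHom q = inversion (ofHom q.swap) := by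
  obtain ⟨a, b⟩ := q
  by_cases ha : a = 0
  · have hb : b ≠ 0 := by rintro rfl; exact hq (by simp [ha])
    rw [ofHom_of_ne (by exact hb), ofHom_of_eq (by exact ha), inversion_infty, ha, zero_div]
  · rw [ofHom_of_ne (q := (a, b).swap) (by exact ha)]
    by_cases hb : b = 0
    · simp [ofHom_of_eq, hb, inversion_zero]
    · rw [ofHom_of_ne (by exact hb), inversion_coe_of_ne (by simp [ha, hb])]
      simp

/-- Limits of coefficient matrices thus become limits of points on the sphere, with `∞` on the same
footing as finite points. -/
theorem continuousAt_ofHom {q : ℂ × ℂ} (hq : q ≠ 0) : ContinuousAt ofHom q := by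
  have key : ∀ q : ℂ × ℂ, q.2 ≠ 0 → ContinuousAt ofHom q := by
    intro q hq
    have h1 : ContinuousAt (fun q : ℂ × ℂ => ((q.1 / q.2 : ℂ) : Sphere)) q :=
      OnePoint.continuous_coe.continuousAt.comp
        (f := fun q : ℂ × ℂ => q.1 / q.2) (continuousAt_fst.div continuousAt_snd hq)
    refine h1.congr ?_
    filter_upwards [continuousAt_snd.eventually_ne hq] with r hr
    exact (ofHom_of_ne hr).symm
  by_cases h : q.2 = 0
  · have h1 : q.1 ≠ 0 := fun h1 => hq (Prod.ext h1 h)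
    have h2 : ContinuousAt (fun r : ℂ × ℂ => inversion (ofHom r.swap)) q :=
      continuous_inversion.continuousAt.comp
        (f := fun r : ℂ × ℂ => ofHom r.swap)
        ((key q.swap h1).comp (f := Prod.swap) continuous_swap.continuousAt)
    refine h2.congr ?_
    filter_upwards [isOpen_ne.mem_nhds hq] with r hr
    exact (ofHom_eq_inversion hr).symm
  · exact key q h

end Sphere

/-! ### Real `2 × 2` matrices acting on homogeneous coordinates -/

namespace MobiusR

open Sphere

/-- The action of a real `2 × 2` array of coefficients on homogeneous coordinates. -/
def act (m : Fin 2 → Fin 2 → ℝ) (q : ℂ × ℂ) : ℂ × ℂ :=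
  (m 0 0 * q.1 + m 0 1 * q.2, m 1 0 * q.1 + m 1 1 * q.2)

/-- The adjugate of a `2 × 2` array. -/
def adj (m : Fin 2 → Fin 2 → ℝ) : Fin 2 → Fin 2 → ℝ := ![![m 1 1, -m 0 1], ![-m 1 0, m 0 0]]

theorem act_adj (m : Fin 2 → Fin 2 → ℝ) (q : ℂ × ℂ) :
    act (adj m) q = (m 1 1 * q.1 - m 0 1 * q.2, -(m 1 0 * q.1) + m 0 0 * q.2) := by
  simp [act, adj, sub_eq_add_neg]

theorem adj_adj (m : Fin 2 → Fin 2 → ℝ) : adj (adj m) = m := by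
  ext i j
  fin_cases i <;> fin_cases j <;> simp [adj]

theorem continuous_act (q : ℂ × ℂ) : Continuous fun m => act m q := by
  unfold act
  fun_prop

theorem continuous_adj : Continuous adj := by
  refine continuous_pi fun i => continuous_pi fun j => ?_
  fin_cases i <;> fin_cases j <;> simp [adj] <;> fun_prop

theorem act_smul (r : ℝ) (m : Fin 2 → Fin 2 → ℝ) (q : ℂ × ℂ) :
    act (r • m) q = (r : ℂ) • act m q := by
  ext <;> simp [act] <;> ring

theorem adj_smul (r : ℝ) (m : Fin 2 → Fin 2 → ℝ) : adj (r • m) = r • adj m := by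
  ext i j
  fin_cases i <;> fin_cases j <;> simp [adj]

/-- A nonzero real matrix does not annihilate a non-real vector. -/
theorem act_ne_zero {m : Fin 2 → Fin 2 → ℝ} (hm : m ≠ 0) {z : ℂ} (hz : 0 < z.im) :
    act m (z, 1) ≠ 0 := by
  intro h
  apply hm
  have key : ∀ a b : ℝ, (a : ℂ) * z + b * 1 = 0 → a = 0 ∧ b = 0 := by
    intro a b hab
    have him := congrArg Complex.im hab
    have hre := congrArg Complex.re hab
    simp at him hre
    have ha : a = 0 := him.resolve_right hz.ne'
    exact ⟨ha, by simpa [ha] using hre⟩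
  have h1 := key _ _ (congrArg Prod.fst h)
  have h2 := key _ _ (congrArg Prod.snd h)
  ext i j
  fin_cases i <;> fin_cases j <;> simp [h1, h2]

theorem adj_ne_zero {m : Fin 2 → Fin 2 → ℝ} (hm : m ≠ 0) : adj m ≠ 0 := by
  intro h
  apply hm
  rw [← adj_adj m, h]
  ext i j
  fin_cases i <;> fin_cases j <;> simp [adj]

/-- A singular nonzero real matrix acts on the complement of its kernel as a constant map. -/
theorem ofHom_act_of_singular {m : Fin 2 → Fin 2 → ℝ} (hm : m ≠ 0)
    (hdet : m 0 0 * m 1 1 - m 0 1 * m 1 0 = 0) {z : ℂ} (hz : 0 < z.im) {q : ℂ × ℂ} (hq : q ≠ 0)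
    (hne : ofHom q ≠ ofHom (act (adj m) (z, 1))) :
    act m q ≠ 0 ∧ ofHom (act m q) = ofHom (act m (z, 1)) := by
  have hd : (m 0 0 : ℂ) * m 1 1 - m 0 1 * m 1 0 = 0 := by exact_mod_cast hdet
  -- The non-real vector `(z, 1)` is a probe that no nonzero real matrix kills: `m` sends it to a
  -- spanning vector of the image of `m`, and `adj m` sends it to one of the kernel.
  have h0 : act m q ≠ 0 := by
    intro h
    refine hne (ofHom_eq_of_cross hq (act_ne_zero (adj_ne_zero hm) hz) ?_)
    have h1 : (m 0 0 : ℂ) * q.1 + m 0 1 * q.2 = 0 := congrArg Prod.fst h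
    have h2 : (m 1 0 : ℂ) * q.1 + m 1 1 * q.2 = 0 := congrArg Prod.snd h
    rw [act_adj]
    linear_combination h1 - z * h2
  refine ⟨h0, ofHom_eq_of_cross h0 (act_ne_zero hm hz) ?_⟩
  simp only [act]
  linear_combination (q.1 - z * q.2) * hd

/-- The coefficients of an element of `SL(2, ℝ)`. -/
def coeffs (g : SL(2, ℝ)) : Fin 2 → Fin 2 → ℝ := fun i j => g i j

theorem coeffs_inv (g : SL(2, ℝ)) : coeffs g⁻¹ = adj (coeffs g) := by
  ext i j
  fin_cases i <;> fin_cases j <;> simp [coeffs, adj, Matrix.SpecialLinearGroup.SL2_inv_expl]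

theorem det_coeffs (g : SL(2, ℝ)) :
    coeffs g 0 0 * coeffs g 1 1 - coeffs g 0 1 * coeffs g 1 0 = 1 := by
  have := g.det_coe
  rwa [Matrix.det_fin_two] at this

theorem coeffs_ne_zero (g : SL(2, ℝ)) : coeffs g ≠ 0 := by
  intro h
  have := det_coeffs g
  simp [h] at this

theorem mk_smul_ofHom (g : SL(2, ℝ)) {q : ℂ × ℂ} (hq : q ≠ 0) :
    (g : PSL(2, ℝ)) • ofHom q = ofHom (act (coeffs g) q) := by
  obtain ⟨a, b⟩ := q
  by_cases hb : b = 0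
  · subst hb
    have ha : a ≠ 0 := by rintro rfl; exact hq rfl
    rw [ofHom_of_eq rfl, mk_smul_infty]
    by_cases h : (g 1 0 : ℂ) = 0
    · rw [if_pos h, ofHom_of_eq]
      simp [act, coeffs, h]
    · rw [if_neg h, ofHom_of_ne (by simp [act, coeffs] at h ⊢; exact ⟨h, ha⟩)]
      simp only [act, coeffs, mul_zero, add_zero]
      rw [mul_div_mul_right _ _ ha]
  · rw [ofHom_of_ne (by exact hb), mk_smul_coe]
    have e : ∀ c d : ℂ, c * (a / b) + d = (c * a + d * b) / b := by intro c d; field_simp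
    simp only [e]
    by_cases h : (g 1 0 : ℂ) * a + g 1 1 * b = 0
    · rw [if_pos (by rw [h, zero_div]), ofHom_of_eq (by exact h)]
    · rw [if_neg (div_ne_zero h hb), ofHom_of_ne (by exact h), div_div_div_cancel_right₀ hb]
      rfl

end MobiusR

/-! ### Convergence to limit points -/

namespace MobiusR

open Sphere

theorem isCompact_norm_coeffs_le (R : ℝ) : IsCompact {g : SL(2, ℝ) | ‖coeffs g‖ ≤ R} := by
  have hemb : IsClosedEmbedding coeffs :=
    Matrix.SpecialLinearGroup.isClosedEmbedding_val (n := Fin 2) (R := ℝ)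
  have h := hemb.isCompact_preimage (isCompact_closedBall (0 : Fin 2 → Fin 2 → ℝ) R)
  simpa only [preimage, mem_closedBall_zero_iff] using h

/-- A closed centre makes the quotient `PSL(2, ℝ)` Hausdorff, and discrete subgroups of a Hausdorff
group are closed. -/
theorem isClosed_center : IsClosed (Subgroup.center SL(2, ℝ) : Set SL(2, ℝ)) := by
  have h : (Subgroup.center SL(2, ℝ) : Set SL(2, ℝ)) = ⋂ h : SL(2, ℝ), {g | h * g = g * h} := by
    ext g
    simp [Subgroup.mem_center_iff]
  rw [h]
  exact isClosed_iInter fun h =>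
    isClosed_eq (continuous_const.mul continuous_id) (continuous_id.mul continuous_const)

instance instT2Space : T2Space PSL(2, ℝ) := by
  have := isClosed_center
  have : T3Space (SL(2, ℝ) ⧸ Subgroup.center SL(2, ℝ)) := QuotientGroup.instT3Space _
  exact inferInstanceAs (T2Space (SL(2, ℝ) ⧸ Subgroup.center SL(2, ℝ)))

/-- A Fuchsian group contains finitely many elements with bounded coefficients. -/
theorem finite_norm_coeffs_le {Γ : Subgroup PSL(2, ℝ)} (hΓ : IsFuchsian Γ) (R : ℝ) :
    {γ : PSL(2, ℝ) | γ ∈ Γ ∧ ∃ g : SL(2, ℝ), ‖coeffs g‖ ≤ R ∧ (g : PSL(2, ℝ)) = γ}.Finite := by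
  have : DiscreteTopology Γ := hΓ
  have hc : IsClosed (Γ : Set PSL(2, ℝ)) := Subgroup.isClosed_of_discrete
  have hK : IsCompact ((fun g : SL(2, ℝ) => (g : PSL(2, ℝ))) '' {g | ‖coeffs g‖ ≤ R}) :=
    (isCompact_norm_coeffs_le R).image QuotientGroup.continuous_mk
  have hd : IsDiscrete (Γ : Set PSL(2, ℝ)) := ⟨hΓ⟩
  exact ((hK.inter_left hc).finite (hd.mono inter_subset_left)).subset fun γ h => h

/-- The coefficients scaled to norm one. -/
def unitCoeffs (g : SL(2, ℝ)) : Fin 2 → Fin 2 → ℝ := ‖coeffs g‖⁻¹ • coeffs g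

theorem norm_coeffs_ne_zero (g : SL(2, ℝ)) : ‖coeffs g‖ ≠ 0 := norm_ne_zero_iff.2 (coeffs_ne_zero g)

theorem norm_unitCoeffs (g : SL(2, ℝ)) : ‖unitCoeffs g‖ = 1 := by
  rw [unitCoeffs, norm_smul, norm_inv, norm_norm, inv_mul_cancel₀ (norm_coeffs_ne_zero g)]

theorem mk_smul_ofHom_unit (g : SL(2, ℝ)) {q : ℂ × ℂ} (hq : q ≠ 0) :
    (g : PSL(2, ℝ)) • ofHom q = ofHom (act (unitCoeffs g) q) := by
  rw [mk_smul_ofHom g hq, unitCoeffs, act_smul,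
    ofHom_smul (by exact_mod_cast inv_ne_zero (norm_coeffs_ne_zero g))]

theorem mk_inv_smul_ofHom_unit (g : SL(2, ℝ)) {q : ℂ × ℂ} (hq : q ≠ 0) :
    (g : PSL(2, ℝ))⁻¹ • ofHom q = ofHom (act (adj (unitCoeffs g)) q) := by
  rw [← QuotientGroup.mk_inv, mk_smul_ofHom g⁻¹ hq, coeffs_inv, unitCoeffs, adj_smul, act_smul,
    ofHom_smul (by exact_mod_cast inv_ne_zero (norm_coeffs_ne_zero g))]

/-- This forces the limit matrix to be singular once the norms tend to infinity. -/
theorem det_unitCoeffs (g : SL(2, ℝ)) :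
    unitCoeffs g 0 0 * unitCoeffs g 1 1 - unitCoeffs g 0 1 * unitCoeffs g 1 0 =
      (‖coeffs g‖⁻¹) ^ 2 := by
  simp only [unitCoeffs, Pi.smul_apply, smul_eq_mul]
  linear_combination (‖coeffs g‖⁻¹) ^ 2 * det_coeffs g

/-- The convergence property: near a limit point `x`, elements of the group converge to the
constant `x` off one point `y`, and their inverses converge to the constant `y` off `x`. -/
theorem exists_ultrafilter_of_mem_limitSet {Γ : Subgroup PSL(2, ℝ)} (hΓ : IsFuchsian Γ)
    {x : Sphere} (hx : x ∈ limitSet Γ) :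
    ∃ (y : Sphere) (f : Ultrafilter SL(2, ℝ)), (∀ᶠ g : SL(2, ℝ) in f, (g : PSL(2, ℝ)) ∈ Γ) ∧
      (∀ p ≠ y, Tendsto (fun g : SL(2, ℝ) => (g : PSL(2, ℝ)) • p) f (𝓝 x)) ∧
      (∀ p ≠ x, Tendsto (fun g : SL(2, ℝ) => (g : PSL(2, ℝ))⁻¹ • p) f (𝓝 y)) := by
  obtain ⟨z, hz, hacc⟩ := hx
  let o : SL(2, ℝ) → Sphere := fun g => (g : PSL(2, ℝ)) • (z : Sphere)
  -- Group elements moving `z` towards `x` without reaching it. Refining to an ultrafilter replaces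
  -- the choice of subsequences.
  let l : Filter SL(2, ℝ) := comap o (𝓝[≠] x) ⊓ 𝓟 {g | (g : PSL(2, ℝ)) ∈ Γ}
  have hl : l.NeBot := by
    rw [← forall_mem_nonempty_iff_neBot]
    intro s hs
    obtain ⟨t, ht, hts⟩ := mem_inf_principal.1 hs
    rw [accPt_iff_frequently] at hacc
    obtain ⟨U, hU, hUt⟩ := mem_nhdsWithin_iff_exists_mem_nhds_inter.1 ht
    obtain ⟨p, ⟨hpx, γ, hγ, rfl⟩, hpU⟩ := (hacc.and_eventually hU).exists
    obtain ⟨g, rfl⟩ := QuotientGroup.mk_surjective γ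
    exact ⟨g, hts (show o g ∈ t from hUt ⟨hpU, hpx⟩) hγ⟩
  let f : Ultrafilter SL(2, ℝ) := Ultrafilter.of l
  have hfl : (f : Filter SL(2, ℝ)) ≤ l := Ultrafilter.of_le l
  have hfΓ : ∀ᶠ g : SL(2, ℝ) in f, (g : PSL(2, ℝ)) ∈ Γ := hfl (mem_inf_of_right (mem_principal_self _))
  have hfo : Tendsto o f (𝓝[≠] x) := tendsto_comap.mono_left (hfl.trans inf_le_left)
  -- Elements of bounded norm give only finitely many orbit points other than `x`, and a
  -- neighbourhood of `x` avoids these.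
  have hnorm : Tendsto (fun g => ‖coeffs g‖) f atTop := by
    refine tendsto_atTop.2 fun R => ?_
    have hfin := ((finite_norm_coeffs_le hΓ R).image fun γ => γ • (z : Sphere)).sdiff (t := {x})
    have hnx : ∀ᶠ g in f, o g ∈ ({x}ᶜ : Set Sphere) := hfo self_mem_nhdsWithin
    have hav := (hfo.mono_right nhdsWithin_le_nhds) (hfin.isClosed.isOpen_compl.mem_nhds
      (fun h => h.2 rfl))
    filter_upwards [hfΓ, hnx, hav] with g h1 h2 h3
    by_contra! h4
    exact h3 ⟨⟨_, ⟨h1, g, h4.le, rfl⟩, rfl⟩, h2⟩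
  obtain ⟨M, hM1, hM⟩ : ∃ M ∈ Metric.sphere (0 : Fin 2 → Fin 2 → ℝ) 1,
      Tendsto unitCoeffs f (𝓝 M) :=
    (isCompact_sphere _ _).ultrafilter_le_nhds (f.map unitCoeffs) (by
      rw [le_principal_iff, Ultrafilter.coe_map]
      exact Filter.mem_map.2 (univ_mem' fun g => mem_sphere_zero_iff_norm.2 (norm_unitCoeffs g)))
  have hM0 : M ≠ 0 := by
    rintro rfl
    simp at hM1
  have hdet : M 0 0 * M 1 1 - M 0 1 * M 1 0 = 0 := by
    have he : ∀ i j, Tendsto (fun g => unitCoeffs g i j) f (𝓝 (M i j)) := fun i j =>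
      tendsto_pi_nhds.1 (tendsto_pi_nhds.1 hM i) j
    refine tendsto_nhds_unique (((he 0 0).mul (he 1 1)).sub ((he 0 1).mul (he 1 0))) ?_
    simp only [det_unitCoeffs]
    simpa using (tendsto_inv_atTop_zero.comp hnorm).pow 2
  have hz0 : ((z, 1) : ℂ × ℂ) ≠ 0 := by simp
  have hlim : ∀ q : ℂ × ℂ, q ≠ 0 → act M q ≠ 0 →
      Tendsto (fun g : SL(2, ℝ) => (g : PSL(2, ℝ)) • ofHom q) f (𝓝 (ofHom (act M q))) := by
    intro q hq hMq
    simp only [mk_smul_ofHom_unit _ hq]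
    exact (continuousAt_ofHom hMq).tendsto.comp (((continuous_act q).tendsto M).comp hM)
  have hlim' : ∀ q : ℂ × ℂ, q ≠ 0 → act (adj M) q ≠ 0 →
      Tendsto (fun g : SL(2, ℝ) => (g : PSL(2, ℝ))⁻¹ • ofHom q) f
        (𝓝 (ofHom (act (adj M) q))) := by
    intro q hq hMq
    simp only [mk_inv_smul_ofHom_unit _ hq]
    exact (continuousAt_ofHom hMq).tendsto.comp
      (((continuous_act q).tendsto (adj M)).comp ((continuous_adj.tendsto M).comp hM))
  have hxM : x = ofHom (act M (z, 1)) := by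
    have h := hlim (z, 1) hz0 (act_ne_zero hM0 hz)
    simp only [ofHom_coe_one] at h
    exact tendsto_nhds_unique (hfo.mono_right nhdsWithin_le_nhds) h
  refine ⟨ofHom (act (adj M) (z, 1)), f, hfΓ, ?_, ?_⟩
  · intro p hp
    obtain ⟨q, hq, rfl⟩ := exists_ofHom p
    obtain ⟨h1, h2⟩ := ofHom_act_of_singular hM0 hdet hz hq hp
    rw [hxM, ← h2]
    exact hlim q hq h1
  · intro p hp
    obtain ⟨q, hq, rfl⟩ := exists_ofHom p
    -- Passing to `adj M` exchanges image and kernel, hence `x` and `y`.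
    obtain ⟨h1, h2⟩ := ofHom_act_of_singular (adj_ne_zero hM0)
      (by simp only [adj]; simp; linarith) hz hq (by rwa [adj_adj, ← hxM])
    rw [← h2]
    exact hlim' q hq h1

end MobiusR

/-! ### Invariant functions -/

open Classical in
/-- The extension by zero of a function on the configuration space. -/
def confTwo.extend (F : confTwo → ℂ) (p : Sphere × Sphere) : ℂ :=
  if h : p.1 ≠ p.2 then F ⟨p, h⟩ else 0

namespace confTwo

theorem extend_of_ne (F : confTwo → ℂ) {p : Sphere × Sphere} (h : p.1 ≠ p.2) :
    extend F p = F ⟨p, h⟩ := dif_pos h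

/-- The configuration space is open, so the default value on the diagonal is not seen near `p`. -/
theorem continuousAt_extend {F : confTwo → ℂ} (hF : Continuous F) {p : Sphere × Sphere}
    (h : p.1 ≠ p.2) : ContinuousAt (extend F) p := by
  have h1 : ContinuousAt (extend F ∘ ((↑) : confTwo → Sphere × Sphere)) ⟨p, h⟩ := by
    have : extend F ∘ ((↑) : confTwo → Sphere × Sphere) = F := by
      ext q
      exact extend_of_ne F q.2
    rw [this]
    exact hF.continuousAt
  exact (confTwo.isOpen.isOpenEmbedding_subtypeVal.continuousAt_iff).1 h1

theorem extend_smul {F : confTwo → ℂ} {γ : PSL(2, ℝ)} (h : ∀ p : confTwo, F (γ • p) = F p)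
    (p q : Sphere) : extend F (γ • p, γ • q) = extend F (p, q) := by
  by_cases hpq : p = q
  · subst hpq
    simp [extend]
  · rw [extend_of_ne F (p := (p, q)) hpq,
      extend_of_ne F (p := (γ • p, γ • q)) fun h => hpq (smul_left_cancel γ h)]
    exact h ⟨(p, q), hpq⟩

/-- Holomorphy in the first variable, in the standard chart. -/
theorem differentiableOn_extend {F : confTwo → ℂ} (hF : HolomorphicOnConfTwo F) (v : ℂ) :
    DifferentiableOn ℂ (fun z : ℂ => extend F ((z : Sphere), (v : Sphere))) {v}ᶜ := by
  intro z₀ hz₀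
  refine DifferentiableAt.differentiableWithinAt ?_
  have hne : ∀ z : ℂ, z ≠ v → (z : Sphere) ≠ (v : Sphere) := fun z hz h =>
    hz (OnePoint.coe_injective h)
  let P : confTwo := ⟨((z₀ : Sphere), (v : Sphere)), hne z₀ hz₀⟩
  have hz : chartAt ℂ (z₀ : Sphere) = Sphere.chartZero := if_neg (OnePoint.coe_ne_infty z₀)
  have hv : chartAt ℂ (v : Sphere) = Sphere.chartZero := if_neg (OnePoint.coe_ne_infty v)
  -- Both coordinates of `P` are finite, so its chart reads a pair of finite points as that pair.
  have hchart : ∀ Q : confTwo, ∀ a b : ℂ, Q.1 = ((a : Sphere), (b : Sphere)) →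
      Q ∈ (extChartAt (𝓘(ℂ).prod 𝓘(ℂ)) P).source ∧
      extChartAt (𝓘(ℂ).prod 𝓘(ℂ)) P Q = (a, b) := by
    intro Q a b hQ
    constructor
    · rw [extChartAt_source, TopologicalSpace.Opens.chartAt_eq]
      simp [P, hQ, hz, hv, Sphere.chartZero_source]
    · simp [extChartAt, TopologicalSpace.Opens.chartAt_eq, P, hQ, hz, hv]
      exact Prod.ext (Sphere.chartZero_coe a) (Sphere.chartZero_coe b)
  have h := (mdifferentiableAt_iff _ _).1 (hF P) |>.2
  rw [(hchart P z₀ v rfl).2, ModelWithCorners.range_eq_univ, differentiableWithinAt_univ] at h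
  have hcomp := h.comp z₀ (f := fun z : ℂ => (z, v)) (by fun_prop)
  refine hcomp.congr_of_eventuallyEq ?_
  filter_upwards [isOpen_ne.mem_nhds hz₀] with z hzv
  obtain ⟨hs, he⟩ := hchart ⟨((z : Sphere), (v : Sphere)), hne z hzv⟩ z v rfl
  rw [extend_of_ne F (hne z hzv)]
  simp only [Function.comp_apply, writtenInExtChartAt, ← he, (extChartAt _ P).left_inv hs]
  rfl

end confTwo

/-- An invariant function is constant along both lines through a limit point. -/
theorem extend_eq_of_mem_limitSet {Γ : Subgroup PSL(2, ℝ)} (hΓ : IsFuchsian Γ)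
    {F : confTwo → ℂ} (hF : Continuous F) (hinv : ∀ γ ∈ Γ, ∀ p : confTwo, F (γ • p) = F p)
    {x : Sphere} (hx : x ∈ limitSet Γ) :
    ∃ y : Sphere, ∀ v ≠ x, ∀ z ≠ y,
      confTwo.extend F (x, v) = confTwo.extend F (z, y) ∧
      confTwo.extend F (v, x) = confTwo.extend F (y, z) := by
  obtain ⟨y, f, hfΓ, h1, h2⟩ := MobiusR.exists_ultrafilter_of_mem_limitSet hΓ hx
  refine ⟨y, fun v hv z hz => ⟨?_, ?_⟩⟩
  · have t1 := (confTwo.continuousAt_extend hF (p := (x, v)) hv.symm).tendsto.comp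
      ((h1 z hz).prodMk_nhds tendsto_const_nhds)
    have t2 := (confTwo.continuousAt_extend hF (p := (z, y)) hz).tendsto.comp
      (tendsto_const_nhds.prodMk_nhds (h2 v hv))
    refine tendsto_nhds_unique_of_eventuallyEq t1 t2 ?_
    filter_upwards [hfΓ] with g hg
    have := confTwo.extend_smul (hinv _ hg) z ((g : PSL(2, ℝ))⁻¹ • v)
    rwa [smul_inv_smul] at this
  · have t1 := (confTwo.continuousAt_extend hF (p := (v, x)) hv).tendsto.comp
      (tendsto_const_nhds.prodMk_nhds (h1 z hz))
    have t2 := (confTwo.continuousAt_extend hF (p := (y, z)) hz.symm).tendsto.comp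
      ((h2 v hv).prodMk_nhds tendsto_const_nhds)
    refine tendsto_nhds_unique_of_eventuallyEq t1 t2 ?_
    filter_upwards [hfΓ] with g hg
    have := confTwo.extend_smul (hinv _ hg) ((g : PSL(2, ℝ))⁻¹ • v) z
    rwa [smul_inv_smul] at this

theorem exists_mem_ne_ne_of_two_lt_encard {α : Type*} {s : Set α} (h : ¬ s.encard ≤ 2) (a b : α) :
    ∃ c ∈ s, c ≠ a ∧ c ≠ b := by
  by_contra! hc
  have h2 : ({a, b} : Set α).encard ≤ 2 :=
    (encard_insert_le {b} a).trans (by rw [encard_singleton, one_add_one_eq_two])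
  refine h ((encard_le_encard fun c hcs => ?_).trans h2)
  by_cases hca : c = a
  · exact Or.inl hca
  · exact Or.inr (hc c hcs hca)

theorem exists_extend_eq_on_limitSet {Γ : Subgroup PSL(2, ℝ)} (hΓ : IsFuchsian Γ)
    (hne : ¬ IsElementary Γ) {F : confTwo → ℂ} (hF : Continuous F)
    (hinv : ∀ γ ∈ Γ, ∀ p : confTwo, F (γ • p) = F p) :
    ∃ c : ℂ, ∀ x ∈ limitSet Γ, ∀ v ≠ x, confTwo.extend F (x, v) = c := by
  have hconst : ∀ x ∈ limitSet Γ, ∀ v ≠ x, ∀ v' ≠ x,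
      confTwo.extend F (x, v) = confTwo.extend F (x, v') ∧
      confTwo.extend F (v, x) = confTwo.extend F (v', x) := by
    intro x hx v hv v' hv'
    obtain ⟨y, hy⟩ := extend_eq_of_mem_limitSet hΓ hF hinv hx
    obtain ⟨z, -, hz, -⟩ := exists_mem_ne_ne_of_two_lt_encard hne y y
    exact ⟨(hy v hv z hz).1.trans (hy v' hv' z hz).1.symm,
      (hy v hv z hz).2.trans (hy v' hv' z hz).2.symm⟩
  obtain ⟨a, ha, -⟩ := exists_mem_ne_ne_of_two_lt_encard hne OnePoint.infty OnePoint.infty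
  obtain ⟨b, hb, hba, -⟩ := exists_mem_ne_ne_of_two_lt_encard hne a a
  refine ⟨confTwo.extend F (a, b), fun x hx v hv => ?_⟩
  by_cases hxa : x = a
  · subst hxa
    exact (hconst x hx v hv b hba).1
  obtain ⟨d, hd, hda, hdx⟩ := exists_mem_ne_ne_of_two_lt_encard hne a x
  -- A third limit point `d` links `x` to `a`: `F(x, v) = F(x, d) = F(a, d) = F(a, b)`.
  rw [(hconst x hx v hv d hdx).1, (hconst d hd x hdx.symm a hda.symm).2,
    (hconst a ha d hda b hba).1]

end

/-! ### From the limit set to the whole configuration space -/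

theorem mainTheorem8 (Γ : Subgroup PSL(2, ℝ)) (hΓ : IsFuchsian Γ) (hne : ¬ IsElementary Γ)
    (F : confTwo → ℂ) (hF : HolomorphicOnConfTwo F)
    (hinv : ∀ γ ∈ Γ, ∀ p : confTwo, F (γ • p) = F p) :
    ∃ c : ℂ, ∀ p : confTwo, F p = c := by
  have hFc : Continuous F := MDifferentiable.continuous hF
  obtain ⟨c, hc⟩ := exists_extend_eq_on_limitSet hΓ hne hFc hinv
  obtain ⟨x', hx, hx', -⟩ := exists_mem_ne_ne_of_two_lt_encard hne OnePoint.infty OnePoint.infty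
  obtain ⟨x, rfl⟩ := OnePoint.ne_infty_iff_exists.1 hx'
  have hfreq : ∃ᶠ z : ℂ in 𝓝[≠] x, ∀ v ≠ (z : Sphere), confTwo.extend F (z, v) = c := by
    obtain ⟨y, f, hfΓ, h1, -⟩ := MobiusR.exists_ultrafilter_of_mem_limitSet hΓ hx
    obtain ⟨a, ha, hay, -⟩ := exists_mem_ne_ne_of_two_lt_encard hne y y
    -- Both `g a` and `g b` approach `x`; being distinct, they cannot both equal `x`.
    obtain ⟨b, hb, hby, hba⟩ := exists_mem_ne_ne_of_two_lt_encard hne y a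
    intro hcon
    rw [eventually_nhdsWithin_iff] at hcon
    have hcon' := OnePoint.isOpenEmbedding_coe.image_mem_nhds.2 hcon
    obtain ⟨g, hg, ⟨z, hz, hza⟩, ⟨w, hw, hwb⟩⟩ :=
      (hfΓ.and (((h1 a hay).eventually hcon').and ((h1 b hby).eventually hcon'))).exists
    -- Invariance of `F` stands in for invariance of the limit set.
    have hE : ∀ p ∈ limitSet Γ, ∀ v ≠ (g : PSL(2, ℝ)) • p,
        confTwo.extend F ((g : PSL(2, ℝ)) • p, v) = c := by
      intro p hp v hv
      have h := confTwo.extend_smul (hinv _ hg) p ((g : PSL(2, ℝ))⁻¹ • v)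
      rw [smul_inv_smul] at h
      rw [h]
      exact hc p hp _ fun h => hv (by rw [← h, smul_inv_smul])
    have key : ∀ t : ℂ, (t ∈ ({x}ᶜ : Set ℂ) →
        ¬ ∀ v ≠ (t : Sphere), confTwo.extend F (t, v) = c) →
        ∀ p ∈ limitSet Γ, (t : Sphere) = (g : PSL(2, ℝ)) • p → t = x := by
      intro t ht p hp htp
      by_contra hne
      exact ht hne (by rw [htp]; exact hE p hp)
    have hzx := key z hz a ha hza
    have hwx := key w hw b hb hwb
    refine hba (smul_left_cancel (g : PSL(2, ℝ)) ?_)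
    rw [← hza, ← hwb, hzx, hwx]
  -- The condition `v ≠ x` keeps the accumulation point `x` inside the connected domain `{v}ᶜ` of
  -- the identity theorem.
  have hplane : ∀ v : ℂ, v ≠ x → ∀ z : ℂ, z ≠ v →
      confTwo.extend F ((z : Sphere), (v : Sphere)) = c := by
    intro v hv z hz
    have hconn : IsPreconnected ({v}ᶜ : Set ℂ) :=
      (isConnected_compl_singleton_of_one_lt_rank (by simp) v).isPreconnected
    refine AnalyticOnNhd.eqOn_of_preconnected_of_frequently_eq
      ((confTwo.differentiableOn_extend hF v).analyticOnNhd isOpen_compl_singleton)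
      (analyticOnNhd_const (v := c)) hconn (z₀ := x) hv.symm ?_ hz
    have hev : ∀ᶠ z : ℂ in 𝓝[≠] x, z ≠ v :=
      nhdsWithin_le_nhds (isOpen_ne.mem_nhds hv.symm)
    refine (hfreq.and_eventually hev).mono fun z hz => ?_
    exact hz.1 _ fun h => hz.2 (OnePoint.coe_injective h).symm
  have hdense : Dense ((Prod.map (↑) (↑) : ℂ × ℂ → Sphere × Sphere) '' {q | q.2 ≠ x}) := by
    refine (OnePoint.denseRange_coe.prodMap OnePoint.denseRange_coe).dense_image
      (OnePoint.continuous_coe.prodMap OnePoint.continuous_coe) ?_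
    have : {q : ℂ × ℂ | q.2 ≠ x} = univ ×ˢ {x}ᶜ := by ext; simp
    rw [this]
    exact dense_univ.prod (dense_compl_singleton x)
  refine ⟨c, fun p => ?_⟩
  rw [← confTwo.extend_of_ne F p.2]
  by_contra hpc
  have hev := ((confTwo.continuousAt_extend hFc p.2).eventually_ne hpc).and
    (confTwo.isOpen.mem_nhds p.2)
  obtain ⟨_, ⟨h1, h2⟩, ⟨z, v⟩, hv, rfl⟩ := mem_closure_iff_nhds.1 (hdense p.1) _ hev
  exact h1 (hplane v hv z fun h => h2 (by simp [h]))
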